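/- Setting. Let $\Omega\subset\mathbb R^m$ be bounded, let $\Sigma$ be a $\sigma$-algebra of Lebesgue measurable subsets of $\Omega$ with $\Omega\in\Sigma$, and let $\lambda$ be Lebesgue measure on $(\Omega,\Sigma)$. Let $T:\Omega\to\Omega$ be a number-theoretic transformation, that is: $T^{-1}\Sigma\subseteq\Sigma$; there are a set of digits $\mathcal D\subset\mathbb N$ and a partition $\Omega=\bigsqcup_{d\in\mathcal D}I_d$ such that each $T_d:=T|_{I_d}$ is continuous and injective; for every finite string $s=[d_1,\dots,d_n]$ of digits the cylinder $C_s=T_{d_1}^{-1}\cdots T_{d_n}^{-1}\Omega=\{x\in\Omega: T^{i}x\in I_{d_{i+1}}\text{ for }0\le i<n\}$ belongs to $\Sigma$ (the string $s$ is called admissible if $C_s\ne\emptyset$); for every $x\in\Omega$ there is a unique infinite sequence of digits $(\mathfrak d_i)_{i\ge1}$ with $\bigcap_n C_{[\mathfrak d_1,\dots,\mathfrak d_n]}=\{x\}$; there is a unique $T$-invariant probability measure $\mu$ on $\Sigma$ that is equivalent to $\lambda$; and $T$ is ergodic with respect to $\mu$. Let $A$ be a finite non-empty set of natural numbers and let $\widetilde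 T(x;a)=(Tx;f_x(a))$ on $\widetilde\Omega=\Omega\times A$ be an augmented transformation: each $f_x:A\to A$ is a bijection, and $\widetilde T$ is measurable and preserves the measure $\tilde\mu$ on $\Omega\times A$ given by $\tilde\mu(B\times\{a\})=\mu(B)/|A|$. The digits of $\widetilde T$ are the pairs $(d,a)\in\mathcal D\times A$, with partition sets $I_d\times\{a\}$, and its cylinders are $\widetilde C_{[(d_1,a_1),\dots,(d_n,a_n)]}=\{y\in\widetilde\Omega:\widetilde T^{i}y\in I_{d_{i+1}}\times\{a_{i+1}\}\text{ for }0\le i<n\}$. A point $x\in\Omega$ is $T$-normal if for every admissible string $s$, $$\lim_{N\to\infty}\frac{\#\{0\le n<N: T^nx\in C_s\}}{N}=\mu(C_s);$$ $\widetilde T$-normality of a point of $\widetilde\Omega$ is defined in the same way, with the cylinders of $\widetilde T$ and the measure $\tilde\mu$. Assume that $\widetilde T$ is staggeringly good, that is: 1. (staggered) there is a string $s=[d_1,\dots,d_n]$ of digits in $\mathcal D$ with $\mu(C_s)>0$ such that for all $a,a'\in A$ there is an $i$ with $0\le i<n$ and $\widetilde T^i(C_s\times\{a'\})\subset\Omega\times\{a\}$;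 2. (full cylinders) all strings are admissible, and $T^nC_s=\Omega$ up to a set of $\mu$-measure $0$ for every string $s$ of $n$ digits; 3. $f_x$ is the same function for all $x$ in a given cylinder $C_{[d]}$, $d\in\mathcal D$; 4. (Rényi's condition) there is a constant $\mathcal C<\infty$ such that for every admissible string $s$ of $n$ digits there is a $\Sigma$-measurable function $\omega_s:\Omega\to[0,\infty)$ with $\lambda(T^{-n}E\cap C_s)=\int_E\omega_s\,d\lambda$ for all $E\in\Sigma$, and $\sup_{x\in\Omega}\omega_s(x)\le\mathcal C\inf_{x\in\Omega}\omega_s(x)$. Theorem. Then $\widetilde T$ is ergodic with respect to $\tilde\mu$. Moreover, for every $x\in\Omega$: $x$ is $T$-normal if and only if $(x;a)$ is $\widetilde T$-normal for every $a\in A$, and also if and only if $(x;a)$ is $\widetilde T$-normal for at least one $a\in A$. -/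

import Mathlib

open MeasureTheory Set Filter Topology
open scoped ENNReal NNReal

namespace NormalNumbers

/-- The cylinder set `C[d₁, …, dₙ] = T_{d₁}⁻¹ ⋯ T_{dₙ}⁻¹ X` of a map `F : X → X` with respect to
a family of sets `J` indexed by digits; here `T_d` is the restriction of `F` to `J d`. -/
def digitCylinder {X δ : Type*} (F : X → X) (J : δ → Set X) : List δ → Set X
  | [] => univ
  | d :: s => J d ∩ F ⁻¹' digitCylinder F J s

/-- A string is admissible if its cylinder set is non-empty. -/
def Admissible {X δ : Type*} (F : X → X) (J : δ → Set X) (s : List δ) : Prop :=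
  (digitCylinder F J s).Nonempty

open Classical in
/-- The number of `0 ≤ n < N` with `Fⁿ x ∈ C`. -/
noncomputable def visits {X : Type*} (F : X → X) (C : Set X) (x : X) (N : ℕ) : ℕ :=
  ((Finset.range N).filter (fun n => F^[n] x ∈ C)).card

/-- `x` is `F`-normal: the orbit of `x` visits the cylinder of each admissible string with
asymptotic frequency equal to the measure of the cylinder. -/
def IsNormal {X δ : Type*} [MeasurableSpace X] (F : X → X) (J : δ → Set X) (μ : Measure X)
    (x : X) : Prop :=
  ∀ s : List δ, Admissible F J s →
    Tendsto (fun N : ℕ => (visits F (digitCylinder F J s) x N : ℝ) / (N : ℝ)) atTop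
      (𝓝 (μ (digitCylinder F J s)).toReal)

/-- Lebesgue measure on the σ-algebra `mΩ` of a set `Ω ⊆ ℝᵐ`: if all members of `mΩ` are Lebesgue
measurable subsets of `ℝᵐ`, the measure of such a member is its volume. -/
noncomputable def lebesgueOn {m : ℕ} (Ω : Set (EuclideanSpace ℝ (Fin m)))
    [mΩ : MeasurableSpace Ω] : Measure Ω :=
  Measure.comap (Subtype.val : Ω → EuclideanSpace ℝ (Fin m)) volume

theorem lebesgueOn_apply {m : ℕ} (Ω : Set (EuclideanSpace ℝ (Fin m))) [mΩ : MeasurableSpace Ω]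
    (h : ∀ B : Set Ω, MeasurableSet B →
      NullMeasurableSet ((Subtype.val : Ω → EuclideanSpace ℝ (Fin m)) '' B) volume)
    (B : Set Ω) (hB : MeasurableSet B) :
    lebesgueOn Ω B = volume ((Subtype.val : Ω → EuclideanSpace ℝ (Fin m)) '' B) :=
  Measure.comap_apply₀ _ _ Subtype.val_injective h hB.nullMeasurableSet

/-- `T` is a number-theoretic transformation of the bounded space `Ω ⊆ ℝᵐ` with σ-algebra `mΩ`
(consisting of Lebesgue measurable sets), digit set `D ⊆ ℕ`, partition `(I d)_{d ∈ D}` and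
invariant probability measure `μ`. -/
structure IsNumberTheoretic {m : ℕ} (Ω : Set (EuclideanSpace ℝ (Fin m))) [mΩ : MeasurableSpace Ω]
    (T : Ω → Ω) (D : Set ℕ) (I : D → Set Ω) (μ : Measure Ω) : Prop where
  bounded : Bornology.IsBounded Ω
  lebesgue_measurable : ∀ B : Set Ω, MeasurableSet B →
    NullMeasurableSet ((Subtype.val : Ω → EuclideanSpace ℝ (Fin m)) '' B) volume
  measurable : Measurable T
  disjoint : ∀ d e : D, d ≠ e → Disjoint (I d) (I e)
  cover : ⋃ d : D, I d = univ
  continuousOn : ∀ d : D, ContinuousOn T (I d)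
  injOn : ∀ d : D, InjOn T (I d)
  measurableSet_cylinder : ∀ s : List D, MeasurableSet (digitCylinder T I s)
  /-- every point has a unique expansion, and is the only point with that expansion -/
  expansion : ∀ x : Ω, ∃! e : ℕ → D,
    ⋂ n : ℕ, digitCylinder T I (List.ofFn (fun i : Fin n => e i)) = {x}
  isProbabilityMeasure : IsProbabilityMeasure μ
  absolutelyContinuous : μ ≪ lebesgueOn Ω
  absolutelyContinuous' : lebesgueOn Ω ≪ μ
  measurePreserving : MeasurePreserving T μ μ
  unique : ∀ ν : Measure Ω, IsProbabilityMeasure ν → ν ≪ lebesgueOn Ω → lebesgueOn Ω ≪ ν →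
    MeasurePreserving T ν ν → ν = μ
  ergodic : Ergodic T μ

/-- The map `(x; a) ↦ (T x; f_x(a))` on `Ω × A`. -/
def augMap {Ω : Type*} {A : Finset ℕ} (T : Ω → Ω) (f : Ω → Equiv.Perm A) : Ω × A → Ω × A :=
  fun p => (T p.1, f p.1 p.2)

/-- The partition of `Ω × A` into the sets `I d × {a}`, indexed by `D × A`. -/
def augDigitSet {Ω δ : Type*} (I : δ → Set Ω) (A : Finset ℕ) : δ × A → Set (Ω × A) :=
  fun q => I q.1 ×ˢ {q.2}

/-- The product of `μ` with the uniform probability measure on `A`. -/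
noncomputable def augMeasure {Ω : Type*} [MeasurableSpace Ω] (μ : Measure Ω) (A : Finset ℕ) :
    Measure (Ω × A) :=
  (A.card : ℝ≥0∞)⁻¹ • μ.prod Measure.count

theorem augMeasure_prod_singleton {Ω : Type*} [MeasurableSpace Ω] (μ : Measure Ω) [SFinite μ]
    (A : Finset ℕ) (B : Set Ω) (a : A) :
    augMeasure μ A (B ×ˢ {a}) = (A.card : ℝ≥0∞)⁻¹ * μ B := by
  simp [augMeasure, Measure.prod_prod]

/-- `(x; a) ↦ (T x; f_x(a))` is an augmented transformation on `Ω × A` over the number-theoretic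
transformation `T`, where `A` is a finite non-empty set of natural numbers. -/
structure IsAugmented {m : ℕ} (Ω : Set (EuclideanSpace ℝ (Fin m))) [mΩ : MeasurableSpace Ω]
    (T : Ω → Ω) (D : Set ℕ) (I : D → Set Ω) (μ : Measure Ω)
    (A : Finset ℕ) (f : Ω → Equiv.Perm A) : Prop where
  base : IsNumberTheoretic Ω T D I μ
  nonempty : A.Nonempty
  measurePreserving : MeasurePreserving (augMap T f) (augMeasure μ A) (augMeasure μ A)

/-- There is a staggered string: a string `s` of `n` digits, with cylinder of positive measure,
such that for all `a, a' ∈ A` some iterate of index `i < n` maps `C_s × {a'}` into `Ω × {a}`. -/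
def IsStaggered {Ω δ : Type*} [MeasurableSpace Ω] (T : Ω → Ω) (I : δ → Set Ω) (μ : Measure Ω)
    (A : Finset ℕ) (f : Ω → Equiv.Perm A) : Prop :=
  ∃ s : List δ, 0 < μ (digitCylinder T I s) ∧
    ∀ a a' : A, ∃ i < s.length,
      (augMap T f)^[i] '' (digitCylinder T I s ×ˢ {a'}) ⊆ univ ×ˢ {a}

/-- `ω` is a density of the measure `E ↦ lam (T⁻ⁿ E ∩ C_s)` with respect to `lam`, where `n` is the
length of `s`. -/
def IsBranchDensity {Ω δ : Type*} [MeasurableSpace Ω] (T : Ω → Ω) (I : δ → Set Ω)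
    (lam : Measure Ω) (s : List δ) (ω : Ω → ℝ≥0) : Prop :=
  Measurable ω ∧ ∀ E : Set Ω, MeasurableSet E →
    lam (T^[s.length] ⁻¹' E ∩ digitCylinder T I s) = ∫⁻ x in E, (ω x : ℝ≥0∞) ∂lam

/-- Rényi's condition, with a constant that works for all admissible strings. The density is
determined only almost everywhere; the condition asks for a suitable version of it. -/
def RenyiCondition {Ω δ : Type*} [MeasurableSpace Ω] (T : Ω → Ω) (I : δ → Set Ω)
    (lam : Measure Ω) : Prop :=
  ∃ K : ℝ≥0, ∀ s : List δ, Admissible T I s →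
    ∃ ω : Ω → ℝ≥0, IsBranchDensity T I lam s ω ∧
      (⨆ x : Ω, (ω x : ℝ≥0∞)) ≤ (K : ℝ≥0∞) * (⨅ x : Ω, (ω x : ℝ≥0∞))

/-- The augmented transformation `(x; a) ↦ (T x; f_x(a))` is staggeringly good. -/
structure IsStaggeringlyGood {m : ℕ} (Ω : Set (EuclideanSpace ℝ (Fin m)))
    [mΩ : MeasurableSpace Ω] (T : Ω → Ω) (D : Set ℕ) (I : D → Set Ω) (μ : Measure Ω)
    (A : Finset ℕ) (f : Ω → Equiv.Perm A) : Prop where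
  augmented : IsAugmented Ω T D I μ A f
  staggered : IsStaggered T I μ A f
  admissible : ∀ s : List D, Admissible T I s
  /-- all cylinders are full: `Tⁿ C_s = Ω` up to a `μ`-null set -/
  full : ∀ s : List D, μ (T^[s.length] '' digitCylinder T I s)ᶜ = 0
  /-- `f_x` depends only on the first digit of `x` -/
  skew_const : ∀ d : D, ∀ x ∈ I d, ∀ y ∈ I d, f x = f y
  renyi : RenyiCondition T I (lebesgueOn Ω)

end NormalNumbers

namespace NormalNumbers

/-! Ergodicity: let `E` be an invariant set with sections `sec a` over the points of `A`. Since `f`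
depends only on the first digit, `n` steps along a cylinder `C_s` carry the level `a` to a single
level `b`, so the part of `C_s` that `T^n` sends into `sec b` lies in `sec a`. Rényi's condition
bounds the proportion of that part in `C_s` below by a multiple of the measure of `sec b`. If some
section is not null, the staggered string makes all of them non-null. As `A` is finite, each section
then fills a fixed proportion of every cylinder, hence is conull (`lebesgueOn_compl_eq_zero`),
because cylinders generate the σ-algebra modulo null sets.

Normality passes up at every point, not just almost every point. For the indicator `φ` of an
augmented cylinder with measure `c`, the mean ergodic theorem gives a length `M` for which `|A_M φ -
c|` has small integral, where `A_M` is the average over `M` steps. This error depends on finitely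
many digits, so normality of `x` makes its average along the orbit small
(`IsNormal.eventually_birkhoffAverage_le`). Since `A_N A_M φ` and `A_N φ` are asymptotically equal,
the frequency tends to `c`. Conversely, `C_s × {b}` is itself an augmented cylinder when `s` is
non-empty, and summing over `b` gives the frequency of `C_s`. -/

/-! ### Comparison of measures on generating families -/

open scoped symmDiff in
-- Approximating with respect to `μ + ν` makes one ring element close to `s` for both measures at
-- once.
theorem measure_le_of_isSetRing {α : Type*} [mα : MeasurableSpace α] {μ ν : Measure α}
    [IsFiniteMeasure μ] [IsFiniteMeasure ν] {C : Set (Set α)} (hC : IsSetRing C)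
    (huniv : univ ∈ C) (hgen : mα = MeasurableSpace.generateFrom C)
    (hle : ∀ t ∈ C, μ t ≤ ν t) {s : Set α} (hs : MeasurableSet s) : μ s ≤ ν s := by
  refine ENNReal.le_of_forall_pos_le_add fun ε hε _ => ?_
  have hε2 : (0 : ℝ≥0∞) < ε / 2 := ENNReal.half_pos (by exact_mod_cast hε.ne')
  obtain ⟨t, ht, hts⟩ := exists_measure_symmDiff_lt_of_generateFrom_isSetRing (μ := μ + ν) hC
    ⟨{univ}, countable_singleton _, by simpa using huniv, by simp⟩ hgen hs hε2
  have h1 : μ (t ∆ s) ≤ ε / 2 := le_trans (by simp) hts.le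
  have h2 : ν (t ∆ s) ≤ ε / 2 := le_trans (by simp) hts.le
  calc μ s ≤ μ (t ∪ t ∆ s) := measure_mono fun x hx => by
        by_cases h : x ∈ t
        · exact Or.inl h
        · exact Or.inr (Or.inr ⟨hx, h⟩)
    _ ≤ μ t + ε / 2 := (measure_union_le _ _).trans (by gcongr)
    _ ≤ ν t + ε / 2 := add_le_add (hle t ht) le_rfl
    _ ≤ ν (s ∪ t ∆ s) + ε / 2 := by
        gcongr
        intro x hx
        by_cases h : x ∈ s
        · exact Or.inl h
        · exact Or.inr (Or.inl ⟨hx, h⟩)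
    _ ≤ (ν s + ε / 2) + ε / 2 := by
        gcongr
        exact (measure_union_le _ _).trans (by gcongr)
    _ = ν s + ε := by rw [add_assoc, ENNReal.add_halves]

/-- Measures on a countable product of countable discrete spaces are compared on cylinders. -/
theorem measure_le_of_prefix {δ : Type*} [Countable δ] [MeasurableSpace δ]
    [MeasurableSingletonClass δ] {μ ν : Measure (ℕ → δ)} [IsFiniteMeasure μ] [IsFiniteMeasure ν]
    (hle : ∀ (n : ℕ) (w : Fin n → δ),
      μ {e | ∀ i : Fin n, e i = w i} ≤ ν {e | ∀ i : Fin n, e i = w i})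
    {s : Set (ℕ → δ)} (hs : MeasurableSet s) : μ s ≤ ν s := by
  refine measure_le_of_isSetRing isSetRing_measurableCylinders
    (univ_mem_measurableCylinders _) generateFrom_measurableCylinders.symm ?_ hs
  intro t ht
  obtain ⟨J, S, hS, rfl⟩ := (mem_measurableCylinders t).1 ht
  obtain ⟨n, hn⟩ : ∃ n, J ⊆ Finset.range n := J.exists_nat_subset_range
  let p : (ℕ → δ) → (Fin n → δ) := fun e i => e i
  have hp : Measurable p := measurable_pi_lambda _ fun i => measurable_pi_apply _
  -- All coordinates in `J` are below `n`, so the cylinder is a union of prefix sets. There are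
  -- countably many prefixes of length `n`, so comparing single prefixes suffices.
  have hcyl : cylinder J S = p ⁻¹' (p '' cylinder J S) := by
    refine Subset.antisymm (subset_preimage_image _ _) ?_
    rintro e ⟨e', he', h⟩
    have : J.restrict e = J.restrict e' := by
      funext j
      exact (congrFun h ⟨j, Finset.mem_range.1 (hn j.2)⟩).symm
    simpa [cylinder, this] using he'
  have key : μ.map p ≤ ν.map p := by
    have hm : ∀ s : Set (Fin n → δ), MeasurableSet s := fun s => s.to_countable.measurableSet
    rw [Measure.le_iff]
    intro s _
    rw [← Measure.tsum_indicator_apply_singleton _ _ (hm s),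
      ← Measure.tsum_indicator_apply_singleton _ _ (hm s)]
    refine ENNReal.tsum_le_tsum fun w => indicator_le_indicator ?_
    rw [Measure.map_apply hp (hm _), Measure.map_apply hp (hm _)]
    convert hle n w using 2 <;>
    · ext e
      simp [p, funext_iff]
  have := key (p '' cylinder J S)
  have hm : MeasurableSet (p '' cylinder J S) := (to_countable _).measurableSet
  rwa [Measure.map_apply hp hm, Measure.map_apply hp hm, ← hcyl] at this

/-! ### Mean ergodic theorem -/

/-- The mean ergodic theorem in `L¹`. -/
theorem tendsto_integral_abs_birkhoffAverage_sub {α : Type*} [MeasurableSpace α] {μ : Measure α}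
    [IsProbabilityMeasure μ] {F : α → α} (hF : Ergodic F μ) {φ : α → ℝ} (hφ : MemLp φ 2 μ) :
    Tendsto (fun n => ∫ y, |birkhoffAverage ℝ F φ n y - ∫ z, φ z ∂μ| ∂μ) atTop (𝓝 0) := by
  have hFm := hF.toMeasurePreserving
  -- Koopman operator on `L²`: von Neumann's theorem gives a fixed limit `p`, which ergodicity
  -- forces to be a constant `k`.
  let V := (Lp.compMeasurePreservingₗᵢ ℝ (E := ℝ) (p := 2) F hFm).toContinuousLinearMap
  have hV : ∀ g, V g = Lp.compMeasurePreserving F hFm g := fun g => rfl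
  obtain ⟨p, hp, hlim⟩ : ∃ p, V p = p ∧
      Tendsto (birkhoffAverage ℝ V _root_.id · (hφ.toLp φ)) atTop (𝓝 p) :=
    ⟨_, LinearMap.mem_eqLocus.1 (SetLike.coe_mem _),
      V.tendsto_birkhoffAverage_orthogonalProjection
        (LinearIsometry.norm_toContinuousLinearMap_le _) _⟩
  obtain ⟨k, hk⟩ : ∃ k : ℝ, (p : α → ℝ) =ᵐ[μ] Function.const α k := by
    refine hF.ae_eq_const_of_ae_eq_comp_ae (Lp.aestronglyMeasurable p) ?_
    have := Lp.coeFn_compMeasurePreserving p hFm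
    rw [← hV, hp] at this
    exact this.symm
  have hiter : ∀ j : ℕ, ((V^[j] (hφ.toLp φ) : Lp ℝ 2 μ) : α → ℝ) =ᵐ[μ] φ ∘ F^[j] := by
    intro j
    induction j with
    | zero => exact hφ.coeFn_toLp
    | succ j ih =>
      rw [Function.iterate_succ_apply', hV]
      refine (Lp.coeFn_compMeasurePreserving _ hFm).trans ?_
      rw [Function.iterate_succ, ← Function.comp_assoc]
      exact hFm.quasiMeasurePreserving.ae_eq_comp ih
  have hav : ∀ n, ((birkhoffAverage ℝ V _root_.id n (hφ.toLp φ) : Lp ℝ 2 μ) : α → ℝ) =ᵐ[μ]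
      birkhoffAverage ℝ F φ n := by
    intro n
    have hsum : ∀ n, ((birkhoffSum V _root_.id n (hφ.toLp φ) : Lp ℝ 2 μ) : α → ℝ) =ᵐ[μ]
        birkhoffSum F φ n := by
      intro n
      induction n with
      | zero => simpa [birkhoffSum] using Lp.coeFn_zero ℝ 2 μ
      | succ n ih =>
        rw [birkhoffSum_succ]
        filter_upwards [Lp.coeFn_add (birkhoffSum V _root_.id n (hφ.toLp φ))
          (_root_.id (V^[n] (hφ.toLp φ))), ih, hiter n] with y h1 h2 h3
        rw [h1, birkhoffSum_succ, Pi.add_apply, h2]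
        exact congrArg _ h3
    filter_upwards [Lp.coeFn_smul (n : ℝ)⁻¹ (birkhoffSum V _root_.id n (hφ.toLp φ)), hsum n]
      with y h1 h2
    simp only [birkhoffAverage]
    rw [h1, Pi.smul_apply, h2]
  have hL2 : ∀ n, MemLp (birkhoffAverage ℝ F φ n) 2 μ := fun n =>
    (memLp_congr_ae (hav n)).1 (Lp.memLp _)
  have hk1 : Tendsto (fun n => ∫ y, |birkhoffAverage ℝ F φ n y - k| ∂μ) atTop (𝓝 0) := by
    refine squeeze_zero (fun n => integral_nonneg fun y => abs_nonneg _) (fun n => ?_)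
      (tendsto_iff_norm_sub_tendsto_zero.1 hlim)
    have hm : MemLp (fun y => birkhoffAverage ℝ F φ n y - k) 2 μ := (hL2 n).sub (memLp_const k)
    have h1 : ∫ y, |birkhoffAverage ℝ F φ n y - k| ∂μ
        = (eLpNorm (fun y => birkhoffAverage ℝ F φ n y - k) 1 μ).toReal := by
      rw [eLpNorm_one_eq_lintegral_enorm,
        ← integral_norm_eq_lintegral_enorm hm.aestronglyMeasurable]
      rfl
    rw [h1, Lp.norm_def]
    have h2 : eLpNorm (↑↑(birkhoffAverage ℝ V _root_.id n (hφ.toLp φ) - p)) 2 μ =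
        eLpNorm (fun y => birkhoffAverage ℝ F φ n y - k) 2 μ := by
      refine eLpNorm_congr_ae ?_
      filter_upwards [Lp.coeFn_sub (birkhoffAverage ℝ V _root_.id n (hφ.toLp φ)) p, hav n, hk]
        with y h1 h2 h3
      rw [h1, Pi.sub_apply, h2, h3, Function.const_apply]
    rw [h2]
    exact ENNReal.toReal_mono hm.2.ne
      (eLpNorm_le_eLpNorm_of_exponent_le (by norm_num) hm.aestronglyMeasurable)
  have hint : ∀ n : ℕ, n ≠ 0 → ∫ y, birkhoffAverage ℝ F φ n y ∂μ = ∫ z, φ z ∂μ := by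
    intro n hn
    have h1 : ∀ j : ℕ, Integrable (fun y => φ (F^[j] y)) μ := fun j =>
      ((hFm.iterate j).integrable_comp hφ.aestronglyMeasurable).2 (hφ.integrable (by norm_num))
    have h2 : ∀ j : ℕ, ∫ y, φ (F^[j] y) ∂μ = ∫ z, φ z ∂μ := fun j => by
      have := (hFm.iterate j).map_eq
      conv_rhs => rw [← this]
      rw [integral_map (hFm.iterate j).aemeasurable]
      rw [this]
      exact hφ.aestronglyMeasurable
    simp only [birkhoffAverage, birkhoffSum, smul_eq_mul]
    rw [integral_const_mul, integral_finsetSum _ fun j _ => h1 j]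
    simp [h2, hn]
  -- Every average over `n ≠ 0` steps has the integral of `φ`, which identifies the constant.
  have hkeq : k = ∫ z, φ z ∂μ := by
    have : Tendsto (fun _ : ℕ => |(∫ z, φ z ∂μ) - k|) atTop (𝓝 0) := by
      refine squeeze_zero' (Eventually.of_forall fun n => abs_nonneg _) ?_ hk1
      filter_upwards [eventually_ne_atTop 0] with n hn
      rw [← hint n hn]
      have : (∫ y, birkhoffAverage ℝ F φ n y ∂μ) - k
          = ∫ y, (birkhoffAverage ℝ F φ n y - k) ∂μ := by
        rw [integral_sub ((hL2 n).integrable (by norm_num)) (integrable_const _)]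
        simp
      rw [this]
      exact abs_integral_le_integral_abs
    have := tendsto_nhds_unique this tendsto_const_nhds
    linarith [abs_eq_zero.1 this.symm]
  rwa [← hkeq]

/-! ### Digit sequences and cylinders -/

section Itinerary

variable {X δ : Type*} {F : X → X} {J : δ → Set X} {dig : X → δ}

theorem exists_digit (hdisj : ∀ d e : δ, d ≠ e → Disjoint (J d) (J e)) (hcover : ⋃ d, J d = univ) :
    ∃ dig : X → δ, ∀ x d, x ∈ J d ↔ dig x = d := by
  have h : ∀ x, ∃ d, x ∈ J d := fun x => mem_iUnion.1 (hcover ▸ mem_univ x)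
  choose dig hdig using h
  refine ⟨dig, fun x d => ⟨fun hx => ?_, fun hx => hx ▸ hdig x⟩⟩
  by_contra hne
  exact (hdisj _ _ hne).le_bot ⟨hdig x, hx⟩

/-- The sequence of digits of a point. -/
def itinerary (F : X → X) (dig : X → δ) (x : X) : ℕ → δ := fun n => dig (F^[n] x)

theorem mem_digitCylinder_ofFn (hdig : ∀ x d, x ∈ J d ↔ dig x = d) {n : ℕ} (w : Fin n → δ) (x : X) :
    x ∈ digitCylinder F J (List.ofFn w) ↔ ∀ i : Fin n, itinerary F dig x i = w i := by
  induction n generalizing x with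
  | zero => simp [digitCylinder]
  | succ n ih =>
    rw [List.ofFn_succ, digitCylinder, mem_inter_iff, hdig, mem_preimage, ih, Fin.forall_fin_succ]
    rfl

theorem digitCylinder_subset_take (s : List δ) (i : ℕ) :
    digitCylinder F J s ⊆ digitCylinder F J (s.take i) := by
  induction s generalizing i with
  | nil => simp
  | cons d s ih =>
    cases i with
    | zero => exact subset_univ _
    | succ i => exact inter_subset_inter_right _ (preimage_mono (ih i))

theorem measurable_itinerary [MeasurableSpace X] [MeasurableSpace δ] (hF : Measurable F)
    (hdig : Measurable dig) : Measurable (itinerary F dig) :=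
  measurable_pi_lambda _ fun n => hdig.comp (hF.iterate n)

theorem measurableSet_digitCylinder [MeasurableSpace X] (hF : Measurable F)
    (hJ : ∀ d, MeasurableSet (J d)) (s : List δ) : MeasurableSet (digitCylinder F J s) := by
  induction s with
  | nil => exact MeasurableSet.univ
  | cons d s ih => exact (hJ d).inter (hF ih)

/-- A function that is determined by the first `k` digits. -/
def FactorsThroughPrefix {β : Type*} (F : X → X) (dig : X → δ) (k : ℕ) (ψ : X → β) : Prop :=
  ∀ x y, (∀ j < k, itinerary F dig x j = itinerary F dig y j) → ψ x = ψ y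

theorem FactorsThroughPrefix.mono {β : Type*} {ψ : X → β} {k l : ℕ}
    (h : FactorsThroughPrefix F dig k ψ) (hkl : k ≤ l) : FactorsThroughPrefix F dig l ψ :=
  fun x y hxy => h x y fun j hj => hxy j (hj.trans_le hkl)

end Itinerary

/-! ### Elementary properties of Birkhoff averages -/

section Birkhoff

variable {X : Type*} {F : X → X}

theorem visits_div_eq_birkhoffAverage (C : Set X) (x : X) (N : ℕ) :
    (visits F C x N : ℝ) / N = birkhoffAverage ℝ F (C.indicator 1) N x := by
  classical
  simp only [visits, birkhoffAverage, birkhoffSum, smul_eq_mul, div_eq_inv_mul]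
  congr 1
  rw [Finset.card_filter]
  push_cast
  refine Finset.sum_congr rfl fun i _ => ?_
  simp [indicator_apply]

theorem birkhoffAverage_mono {φ ψ : X → ℝ} (N : ℕ) (x : X)
    (h : ∀ y, φ y ≤ ψ y) :
    birkhoffAverage ℝ F φ N x ≤ birkhoffAverage ℝ F ψ N x := by
  simp only [birkhoffAverage, birkhoffSum, smul_eq_mul]
  gcongr
  exact h _

theorem birkhoffAverage_fun_const (c : ℝ) {N : ℕ} (hN : N ≠ 0) (x : X) :
    birkhoffAverage ℝ F (fun _ => c) N x = c := by
  simp [birkhoffAverage, birkhoffSum, hN]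

theorem birkhoffAverage_finset_sum {ι : Type*} (s : Finset ι) (φ : ι → X → ℝ) (N : ℕ) (x : X) :
    birkhoffAverage ℝ F (fun y => ∑ i ∈ s, φ i y) N x
      = ∑ i ∈ s, birkhoffAverage ℝ F (φ i) N x := by
  simp only [birkhoffAverage, birkhoffSum, smul_eq_mul]
  rw [Finset.sum_comm, Finset.mul_sum]

theorem birkhoffAverage_const_mul (c : ℝ) (φ : X → ℝ) (N : ℕ) (x : X) :
    birkhoffAverage ℝ F (fun y => c * φ y) N x = c * birkhoffAverage ℝ F φ N x := by
  simp only [birkhoffAverage, birkhoffSum, smul_eq_mul, ← Finset.mul_sum]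
  ring

theorem abs_birkhoffAverage_sub_le (φ : X → ℝ) (c : ℝ) {N : ℕ} (hN : N ≠ 0) (x : X) :
    |birkhoffAverage ℝ F φ N x - c| ≤ birkhoffAverage ℝ F (fun y => |φ y - c|) N x := by
  have h : birkhoffAverage ℝ F φ N x - c = birkhoffAverage ℝ F (fun y => φ y - c) N x := by
    simp only [birkhoffAverage, birkhoffSum, smul_eq_mul, Finset.sum_sub_distrib]
    simp [mul_sub, hN]
  rw [h]
  simp only [birkhoffAverage, birkhoffSum, smul_eq_mul, abs_mul, abs_inv, Nat.abs_cast]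
  gcongr
  exact Finset.abs_sum_le_sum_abs _ _

theorem birkhoffAverage_mem_Icc {φ : X → ℝ} (hφ : ∀ y, φ y ∈ Icc (0 : ℝ) 1) (N : ℕ) (x : X) :
    birkhoffAverage ℝ F φ N x ∈ Icc (0 : ℝ) 1 := by
  rcases eq_or_ne N 0 with rfl | hN
  · simp
  refine ⟨?_, ?_⟩
  · rw [← birkhoffAverage_fun_const (F := F) 0 hN x]
    exact birkhoffAverage_mono N x fun n => (hφ _).1
  · rw [← birkhoffAverage_fun_const (F := F) 1 hN x]
    exact birkhoffAverage_mono N x fun n => (hφ _).2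

/-- The iterated average is the mean of `M` averages started at `F^[i] x`. For bounded `φ`, each
such shift changes the average by a quantity tending to `0`. -/
theorem tendsto_birkhoffAverage_birkhoffAverage_sub {φ : X → ℝ}
    (hφ : Bornology.IsBounded (range φ)) {M : ℕ} (hM : M ≠ 0) (x : X) :
    Tendsto (fun N => birkhoffAverage ℝ F (birkhoffAverage ℝ F φ M) N x
      - birkhoffAverage ℝ F φ N x) atTop (𝓝 0) := by
  have h1 : ∀ i : ℕ, Tendsto (fun N => birkhoffAverage ℝ F φ N (F^[i] x)
      - birkhoffAverage ℝ F φ N x) atTop (𝓝 0) := by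
    intro i
    induction i with
    | zero => simp
    | succ i ih =>
      rw [← zero_add (0 : ℝ)]
      refine ((tendsto_birkhoffAverage_apply_sub_birkhoffAverage' ℝ hφ F (F^[i] x)).add ih).congr
        fun N => ?_
      rw [Function.iterate_succ_apply']
      ring
  have h2 : Tendsto (fun N => (M : ℝ)⁻¹ * ∑ i ∈ Finset.range M,
      (birkhoffAverage ℝ F φ N (F^[i] x) - birkhoffAverage ℝ F φ N x)) atTop (𝓝 0) := by
    have := (tendsto_finsetSum (Finset.range M) fun i _ => h1 i).const_mul (M : ℝ)⁻¹
    simpa using this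
  refine h2.congr fun N => ?_
  have h3 : birkhoffAverage ℝ F (birkhoffAverage ℝ F φ M) N x
      = (M : ℝ)⁻¹ * ∑ i ∈ Finset.range M, birkhoffAverage ℝ F φ N (F^[i] x) := by
    simp only [birkhoffAverage, birkhoffSum, smul_eq_mul, ← Finset.mul_sum]
    rw [Finset.sum_comm, mul_left_comm]
    simp only [← Function.iterate_add_apply, add_comm]
  rw [h3, Finset.sum_sub_distrib, mul_sub]
  simp [hM]

end Birkhoff

/-! ### Averages of prefix functions along normal orbits -/

section Normal

variable {X δ : Type*} [MeasurableSpace X] [Countable δ] {F : X → X} {J : δ → Set X} {dig : X → δ}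
  {μ : Measure X} [IsProbabilityMeasure μ]

theorem hasSum_measureReal_digitCylinder (hdig : ∀ x d, x ∈ J d ↔ dig x = d)
    (hmeas : ∀ s, MeasurableSet (digitCylinder F J s)) (n : ℕ) :
    HasSum (fun w : Fin n → δ => μ.real (digitCylinder F J (List.ofFn w))) 1 := by
  have hd : Pairwise (Function.onFun Disjoint
      fun w : Fin n → δ => digitCylinder F J (List.ofFn w)) := by
    intro v w hvw
    refine disjoint_left.2 fun x hv hw => hvw ?_
    rw [mem_digitCylinder_ofFn hdig] at hv hw
    funext i
    rw [← hv i, hw i]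
  have hu : ⋃ w : Fin n → δ, digitCylinder F J (List.ofFn w) = univ :=
    eq_univ_of_forall fun x => mem_iUnion.2 ⟨fun i => itinerary F dig x i,
      (mem_digitCylinder_ofFn hdig _ _).2 fun i => rfl⟩
  have h := measure_iUnion (μ := μ) hd fun w => hmeas (List.ofFn w)
  rw [hu, measure_univ] at h
  have h2 : Summable fun w : Fin n → δ => μ.real (digitCylinder F J (List.ofFn w)) :=
    ENNReal.summable_toReal (by rw [← h]; exact ENNReal.one_ne_top)
  convert h2.hasSum
  have h3 := ENNReal.tsum_toReal_eq
    (fun w : Fin n → δ => measure_ne_top μ (digitCylinder F J (List.ofFn w)))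
  rw [← h] at h3
  simpa [measureReal_def] using h3

/-- There may be infinitely many digits, and normality controls only finitely many cylinders
simultaneously. `H` is therefore kept on finitely many cylinders of nearly full mass and replaced by
its upper bound `B` elsewhere, which is why only an upper estimate results. -/
theorem IsNormal.eventually_birkhoffAverage_le (hdig : ∀ x d, x ∈ J d ↔ dig x = d)
    (hmeas : ∀ s, MeasurableSet (digitCylinder F J s)) (hadm : ∀ s, Admissible F J s)
    {x : X} (hx : IsNormal F J μ x) {H : X → ℝ} {k : ℕ} (hk : FactorsThroughPrefix F dig k H)
    (hH : Measurable H) {B : ℝ} (hB : ∀ y, H y ∈ Icc 0 B) {ε : ℝ} (hε : 0 < ε) :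
    ∀ᶠ N in atTop, birkhoffAverage ℝ F H N x ≤ (∫ y, H y ∂μ) + ε := by
  classical
  set S : (Fin k → δ) → Set X := fun w => digitCylinder F J (List.ofFn w) with hS
  have hB0 : 0 ≤ B := (hB x).1.trans (hB x).2
  choose pt hpt using fun w : Fin k → δ => hadm (List.ofFn w)
  have hHw : ∀ w, ∀ y ∈ S w, H y = H (pt w) := by
    intro w y hy
    have h1 := (mem_digitCylinder_ofFn hdig w y).1 hy
    have h2 := (mem_digitCylinder_ofFn hdig w _).1 (hpt w)
    exact hk _ _ fun j hj => (h1 ⟨j, hj⟩).trans (h2 ⟨j, hj⟩).symm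
  -- The denominator `B + 1` keeps the quotient defined when `B = 0` and still gives `B * (ε / (B +
  -- 1)) < ε`.
  obtain ⟨W, hW⟩ : ∃ W : Finset (Fin k → δ), 1 - ε / (B + 1) < ∑ w ∈ W, μ.real (S w) :=
    ((hasSum_measureReal_digitCylinder (μ := μ) hdig hmeas k).eventually
      (lt_mem_nhds (sub_lt_self _ (by positivity)))).exists
  -- The index `none` contributes the constant `B`; a word of `W` corrects it to the value of `H` on
  -- its cylinder.
  have hpoint : ∀ y, H y ≤ ∑ w ∈ insert none (W.map Function.Embedding.some),
      (w.elim B fun w => H (pt w) - B) * (w.elim univ S : Set X).indicator 1 y := by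
    intro y
    rw [Finset.sum_insert (by simp), Finset.sum_map]
    simp only [Option.elim, Function.Embedding.some_apply, indicator_univ, Pi.one_apply, mul_one]
    set v : Fin k → δ := fun i => itinerary F dig y i
    have hyv : ∀ w, y ∈ S w ↔ v = w := fun w => by
      rw [hS, mem_digitCylinder_ofFn hdig, funext_iff]
    have hsum : ∑ w ∈ W, (H (pt w) - B) * (S w).indicator (1 : X → ℝ) y
        = if v ∈ W then H y - B else 0 := by
      rw [← Finset.sum_ite_eq W v fun _ => H y - B]
      refine Finset.sum_congr rfl fun w _ => ?_
      by_cases h : v = w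
      · simp [indicator_of_mem ((hyv w).2 h), h, hHw w y ((hyv w).2 h)]
      · simp [indicator_of_notMem (fun h' => h ((hyv w).1 h')), h]
    rw [hsum]
    split_ifs
    · linarith
    · linarith [(hB y).2]
  have hlim : Tendsto (fun N : ℕ => ∑ w ∈ W, (H (pt w) - B) *
      birkhoffAverage ℝ F ((S w).indicator 1) N x) atTop
      (𝓝 (∑ w ∈ W, (H (pt w) - B) * μ.real (S w))) := by
    refine tendsto_finsetSum _ fun w _ => Tendsto.const_mul _ ?_
    refine (hx _ (hadm (List.ofFn w))).congr fun N => visits_div_eq_birkhoffAverage _ _ _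
  have hle : ∑ w ∈ W, H (pt w) * μ.real (S w) ≤ ∫ y, H y ∂μ := by
    have hHi : Integrable H μ := Integrable.of_bound hH.aestronglyMeasurable B
      (Eventually.of_forall fun y => by
        rw [Real.norm_eq_abs, abs_of_nonneg (hB y).1]; exact (hB y).2)
    have h1 : ∀ w ∈ W, Integrable (fun y => H (pt w) * (S w).indicator (1 : X → ℝ) y) μ :=
      fun w _ => ((integrable_const (1 : ℝ)).indicator (hmeas _)).const_mul _
    have h2 : ∑ w ∈ W, H (pt w) * μ.real (S w)
        = ∫ y, ∑ w ∈ W, H (pt w) * (S w).indicator (1 : X → ℝ) y ∂μ := by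
      rw [integral_finsetSum _ h1]
      refine Finset.sum_congr rfl fun w _ => ?_
      rw [integral_const_mul, integral_indicator_one (hmeas _)]
    rw [h2]
    refine integral_mono (integrable_finsetSum _ h1) hHi fun y => ?_
    have hyv : ∀ w, y ∈ S w ↔ (fun i : Fin k => itinerary F dig y i) = w := fun w => by
      rw [hS, mem_digitCylinder_ofFn hdig, funext_iff]
    have hsum : ∑ w ∈ W, H (pt w) * (S w).indicator (1 : X → ℝ) y
        = if (fun i : Fin k => itinerary F dig y i) ∈ W then H y else 0 := by
      rw [← Finset.sum_ite_eq W _ fun _ => H y]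
      refine Finset.sum_congr rfl fun w _ => ?_
      by_cases h : (fun i : Fin k => itinerary F dig y i) = w
      · simp [indicator_of_mem ((hyv w).2 h), h, hHw w y ((hyv w).2 h)]
      · simp [indicator_of_notMem (fun h' => h ((hyv w).1 h')), h]
    simp only [hsum]
    split_ifs
    · exact le_rfl
    · exact (hB y).1
  have hlt : (∑ w ∈ W, (H (pt w) - B) * μ.real (S w)) < (∫ y, H y ∂μ) + ε - B := by
    simp only [sub_mul, Finset.sum_sub_distrib, ← Finset.mul_sum]
    have h3 : B * (ε / (B + 1)) < ε := by
      rw [mul_div_assoc', div_lt_iff₀ (by positivity)]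
      nlinarith
    nlinarith [mul_le_mul_of_nonneg_left hW.le hB0]
  filter_upwards [hlim.eventually (gt_mem_nhds hlt), eventually_ne_atTop 0] with N hN hN0
  refine (birkhoffAverage_mono N x hpoint).trans ?_
  rw [birkhoffAverage_finset_sum]
  simp only [birkhoffAverage_const_mul]
  rw [Finset.sum_insert (by simp), Finset.sum_map]
  simp only [Option.elim, Function.Embedding.some_apply, indicator_univ]
  have h1 : birkhoffAverage ℝ F (1 : X → ℝ) N x = 1 := birkhoffAverage_fun_const 1 hN0 x
  rw [h1]
  linarith

end Normal

/-! ### Iterates of the augmented map over a cylinder -/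

section Augmented

variable {Ω δ : Type*} {T : Ω → Ω} {I : δ → Set Ω} {A : Finset ℕ} {f : Ω → Equiv.Perm A}

theorem exists_skew_eq (hskew : ∀ d, ∀ x ∈ I d, ∀ y ∈ I d, f x = f y) (d : δ) :
    ∃ g : Equiv.Perm A, ∀ x ∈ I d, f x = g := by
  rcases (I d).eq_empty_or_nonempty with h | ⟨y, hy⟩
  · exact ⟨1, by simp [h]⟩
  · exact ⟨f y, fun x hx => hskew d x hx y hy⟩

/-- The permutations applied along the orbit are dictated by the digits of `s`, so the final level
`b` is common to the whole cylinder. -/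
theorem exists_augMap_iterate_eq (hskew : ∀ d, ∀ x ∈ I d, ∀ y ∈ I d, f x = f y)
    (s : List δ) (a : A) : ∃ b : A, ∀ x ∈ digitCylinder T I s,
      (augMap T f)^[s.length] (x, a) = (T^[s.length] x, b) := by
  induction s generalizing a with
  | nil => exact ⟨a, fun x _ => rfl⟩
  | cons d s ih =>
    obtain ⟨g, hg⟩ := exists_skew_eq hskew d
    obtain ⟨b, hb⟩ := ih (g a)
    refine ⟨b, fun x hx => ?_⟩
    rw [List.length_cons, Function.iterate_succ_apply, Function.iterate_succ_apply,
      ← hb _ hx.2, ← hg x hx.1]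
    rfl

theorem augMap_iterate_fst (n : ℕ) (p : Ω × A) : ((augMap T f)^[n] p).1 = T^[n] p.1 := by
  induction n generalizing p with
  | zero => rfl
  | succ n ih => rw [Function.iterate_succ_apply, Function.iterate_succ_apply, ih]; rfl

theorem augMeasure_eq_zero [MeasurableSpace Ω] {μ : Measure Ω} [SFinite μ] {E : Set (Ω × A)}
    (h : ∀ a : A, μ {x | (x, a) ∈ E} = 0) : augMeasure μ A E = 0 := by
  refine measure_mono_null (t := ⋃ a : A, {x | (x, a) ∈ E} ×ˢ {a}) ?_ ?_
  · rintro ⟨x, a⟩ hx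
    exact mem_iUnion.2 ⟨a, hx, rfl⟩
  · refine measure_iUnion_null fun a => ?_
    rw [augMeasure_prod_singleton, h a, mul_zero]

end Augmented

/-! ### Generation by cylinders and ergodicity of the augmented map -/

section NumberTheoretic

variable {m : ℕ} {Ω : Set (EuclideanSpace ℝ (Fin m))} [mΩ : MeasurableSpace Ω]
  {T : Ω → Ω} {D : Set ℕ} {I : D → Set Ω} {μ : Measure Ω}

theorem IsNumberTheoretic.isFiniteMeasure_lebesgueOn (hT : IsNumberTheoretic Ω T D I μ) :
    IsFiniteMeasure (lebesgueOn Ω) := by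
  refine ⟨?_⟩
  rw [lebesgueOn_apply Ω hT.lebesgue_measurable _ MeasurableSet.univ, image_univ,
    Subtype.range_coe]
  exact hT.bounded.measure_lt_top

theorem IsNumberTheoretic.measurableSet_digit (hT : IsNumberTheoretic Ω T D I μ) (d : D) :
    MeasurableSet (I d) := by
  simpa [digitCylinder] using hT.measurableSet_cylinder [d]

theorem IsNumberTheoretic.measurable_digit (hT : IsNumberTheoretic Ω T D I μ) {dig : Ω → D}
    (hdig : ∀ x d, x ∈ I d ↔ dig x = d) : Measurable dig := by
  refine measurable_to_countable' fun d => ?_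
  convert hT.measurableSet_digit d using 1
  ext x
  exact (hdig x d).symm

theorem IsNumberTheoretic.itinerary_injective (hT : IsNumberTheoretic Ω T D I μ) {dig : Ω → D}
    (hdig : ∀ x d, x ∈ I d ↔ dig x = d) : Function.Injective (itinerary T dig) := by
  intro x y hxy
  obtain ⟨e, he, -⟩ := hT.expansion x
  have hx : x ∈ ⋂ n : ℕ, digitCylinder T I (List.ofFn (fun i : Fin n => e i)) := by
    rw [he]; rfl
  have hy : y ∈ ⋂ n : ℕ, digitCylinder T I (List.ofFn (fun i : Fin n => e i)) := by
    simp only [mem_iInter, mem_digitCylinder_ofFn hdig] at hx ⊢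
    rwa [← hxy]
  rw [he] at hy
  exact hy.symm

/-- Modulo null sets, the cylinders generate the σ-algebra of a number-theoretic
transformation. -/
theorem IsNumberTheoretic.exists_ae_eq_preimage_itinerary (hT : IsNumberTheoretic Ω T D I μ)
    {dig : Ω → D} (hdig : ∀ x d, x ∈ I d ↔ dig x = d) {E : Set Ω} (hE : MeasurableSet E) :
    ∃ S : Set (ℕ → D), MeasurableSet S ∧ E =ᵐ[lebesgueOn Ω] itinerary T dig ⁻¹' S := by
  have hmi := measurable_itinerary hT.measurable (hT.measurable_digit hdig)
  have hnull : ∀ n d, NullMeasurableSet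
      ((Subtype.val : Ω → EuclideanSpace ℝ (Fin m)) '' {x | itinerary T dig x n = d}) volume :=
    fun n d => hT.lebesgue_measurable _
      (((measurable_pi_apply n).comp hmi) (measurableSet_singleton d))
  -- The σ-algebra on `Ω` is an arbitrary one of Lebesgue measurable sets. Borel subsets of full
  -- measure in the digit sets produce a Borel set `Ω'`, conull in `Ω`, on which the itinerary is
  -- Borel.
  choose t htsub htmeas htae using fun n d => (hnull n d).exists_measurable_subset_ae_eq
  obtain ⟨tE, htEsub, htEmeas, htEae⟩ :=
    (hT.lebesgue_measurable E hE).exists_measurable_subset_ae_eq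
  set Ω' : Set (EuclideanSpace ℝ (Fin m)) := ⋂ n, ⋃ d, t n d with hΩ'
  have hΩ'meas : MeasurableSet Ω' :=
    MeasurableSet.iInter fun n => MeasurableSet.iUnion fun d => htmeas n d
  have hsub : Ω' ⊆ Ω := by
    intro y hy
    obtain ⟨d, hd⟩ := mem_iUnion.1 (mem_iInter.1 hy 0)
    obtain ⟨x, -, rfl⟩ := htsub _ _ hd
    exact x.2
  have hdiff : volume (Ω \ Ω') = 0 := by
    refine measure_mono_null (t := ⋃ n, ⋃ d,
      ((Subtype.val : Ω → EuclideanSpace ℝ (Fin m)) '' {x | itinerary T dig x n = d}) \ t n d)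
      ?_ (measure_iUnion_null fun n => measure_iUnion_null fun d =>
        ae_le_set.1 (htae n d).symm.le)
    rintro y ⟨hy, hy'⟩
    obtain ⟨n, hn⟩ : ∃ n, ∀ d, y ∉ t n d := by simpa [hΩ'] using hy'
    exact mem_iUnion.2 ⟨n, mem_iUnion.2 ⟨_, ⟨⟨y, hy⟩, rfl, rfl⟩, hn _⟩⟩
  let c : Ω' → ℕ → D := fun y => itinerary T dig ⟨y, hsub y.2⟩
  have hval : ∀ n d (y : Ω'), y.1 ∈ t n d → c y n = d := by
    intro n d y hy
    obtain ⟨x, hx, hxy⟩ := htsub _ _ hy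
    obtain rfl : x = ⟨y, hsub y.2⟩ := Subtype.ext hxy
    exact hx
  have hcmeas : Measurable c := by
    refine measurable_pi_lambda _ fun n => measurable_to_countable' fun d => ?_
    convert measurable_subtype_coe (htmeas n d) using 1
    ext y
    refine ⟨fun h => ?_, hval n d y⟩
    obtain ⟨d', hd'⟩ := mem_iUnion.1 (mem_iInter.1 y.2 n)
    have : d' = d := (hval n d' y hd').symm.trans h
    exact this ▸ hd'
  have hcinj : Function.Injective c := fun y z hyz => by
    have := hT.itinerary_injective hdig hyz
    exact Subtype.ext (congrArg (fun x : Ω => x.1) this)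
  have := hΩ'meas.standardBorel
  -- Lusin–Souslin: an injective Borel map on a standard Borel space sends Borel sets to Borel sets,
  -- so the image of `tE` can serve as `S`.
  have hemb : MeasurableEmbedding c := hcmeas.measurableEmbedding hcinj
  have hS : MeasurableSet (c '' (Subtype.val ⁻¹' tE)) :=
    hemb.measurableSet_image.2 (measurable_subtype_coe htEmeas)
  refine ⟨_, hS, ?_⟩
  have hle : itinerary T dig ⁻¹' (c '' (Subtype.val ⁻¹' tE)) ⊆ E := by
    rintro x ⟨y, hy, hyx⟩
    have hxy := hT.itinerary_injective hdig hyx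
    obtain ⟨z, hz, hzy⟩ := htEsub hy
    have : z = x := (Subtype.ext hzy).trans hxy
    exact this ▸ hz
  refine (ae_le_set.2 ?_).antisymm (LE.le.eventuallyLE hle)
  rw [lebesgueOn_apply Ω hT.lebesgue_measurable _ (hE.diff (hmi hS))]
  refine measure_mono_null (t := (Ω \ Ω') ∪ (Subtype.val '' E \ tE)) ?_
    (measure_union_null hdiff (ae_le_set.1 htEae.symm.le))
  rintro _ ⟨x, ⟨hxE, hx⟩, rfl⟩
  by_cases h1 : x.1 ∈ Ω'
  · refine Or.inr ⟨⟨x, hxE, rfl⟩, fun h2 => hx ⟨⟨x.1, h1⟩, h2, rfl⟩⟩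
  · exact Or.inl ⟨x.2, h1⟩

/-- A set that occupies a definite proportion of every cylinder has full measure. -/
theorem IsNumberTheoretic.lebesgueOn_compl_eq_zero (hT : IsNumberTheoretic Ω T D I μ)
    {E : Set Ω} (hE : MeasurableSet E) {c M : ℝ≥0∞} (hc0 : c ≠ 0) (hc : c ≠ ∞) (hM : M ≠ ∞)
    (h : ∀ s : List D, c * lebesgueOn Ω (digitCylinder T I s)
      ≤ M * lebesgueOn Ω (digitCylinder T I s ∩ E)) : lebesgueOn Ω Eᶜ = 0 := by
  obtain ⟨dig, hdig⟩ := exists_digit hT.disjoint hT.cover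
  have hmi := measurable_itinerary hT.measurable (hT.measurable_digit hdig)
  have := hT.isFiniteMeasure_lebesgueOn
  obtain ⟨S, hS, hES⟩ := hT.exists_ae_eq_preimage_itinerary hdig hE.compl
  have := Measure.smul_finite ((lebesgueOn Ω).map (itinerary T dig)) hc
  have := Measure.smul_finite (((lebesgueOn Ω).restrict E).map (itinerary T dig)) hM
  -- In sequence space the hypothesis is an inequality of finite measures on prefix sets, hence on
  -- all measurable sets. At `S`, which represents `Eᶜ`, the right side vanishes.
  have key := measure_le_of_prefix (μ := c • (lebesgueOn Ω).map (itinerary T dig))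
    (ν := M • ((lebesgueOn Ω).restrict E).map (itinerary T dig)) (fun n w => by
      have hm : MeasurableSet {e : ℕ → D | ∀ i : Fin n, e i = w i} := by
        rw [ofPred_forall]
        exact MeasurableSet.iInter fun i => measurable_pi_apply _ (measurableSet_singleton _)
      have hpre : itinerary T dig ⁻¹' {e : ℕ → D | ∀ i : Fin n, e i = w i}
          = digitCylinder T I (List.ofFn w) :=
        ext fun x => (mem_digitCylinder_ofFn hdig w x).symm
      rw [Measure.smul_apply, Measure.smul_apply, Measure.map_apply hmi hm,
        Measure.map_apply hmi hm, Measure.restrict_apply (hmi hm), hpre]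
      exact h _) hS
  rw [Measure.smul_apply, Measure.smul_apply, Measure.map_apply hmi hS, Measure.map_apply hmi hS,
    Measure.restrict_apply (hmi hS), ← measure_congr hES,
    ← measure_congr (hES.inter (ae_eq_refl E)), compl_inter_self] at key
  simpa [hc0] using key

/-- Bounded distortion: `lam C_s` is at most `sup ω * lam univ`, the pulled-back part is at least
`inf ω * lam E`, and `sup ω ≤ K * inf ω`. Hence `M = K * lam univ`. -/
theorem RenyiCondition.exists_mul_le {X δ : Type*} [MeasurableSpace X] {F : X → X}
    {J : δ → Set X} {lam : Measure X} [IsFiniteMeasure lam] (h : RenyiCondition F J lam) :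
    ∃ M : ℝ≥0∞, M ≠ ∞ ∧ ∀ s : List δ, Admissible F J s → ∀ E : Set X, MeasurableSet E →
      lam E * lam (digitCylinder F J s) ≤ M * lam (F^[s.length] ⁻¹' E ∩ digitCylinder F J s) := by
  obtain ⟨K, hK⟩ := h
  refine ⟨K * lam univ, ENNReal.mul_ne_top ENNReal.coe_ne_top (measure_ne_top _ _),
    fun s hs E hE => ?_⟩
  obtain ⟨ω, ⟨-, hω⟩, hsup⟩ := hK s hs
  have h1 : lam (digitCylinder F J s) ≤ (⨆ x, (ω x : ℝ≥0∞)) * lam univ := by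
    have := hω univ MeasurableSet.univ
    rw [preimage_univ, univ_inter, setLIntegral_univ] at this
    rw [this, ← lintegral_const]
    exact lintegral_mono fun x => le_iSup (fun x => (ω x : ℝ≥0∞)) x
  have h2 : (⨅ x, (ω x : ℝ≥0∞)) * lam E ≤ lam (F^[s.length] ⁻¹' E ∩ digitCylinder F J s) := by
    rw [hω E hE, ← setLIntegral_const]
    exact lintegral_mono fun x => iInf_le (fun x => (ω x : ℝ≥0∞)) x
  calc lam E * lam (digitCylinder F J s)
      ≤ lam E * ((K * ⨅ x, (ω x : ℝ≥0∞)) * lam univ) := by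
        gcongr
        exact h1.trans (by gcongr)
    _ = K * lam univ * ((⨅ x, (ω x : ℝ≥0∞)) * lam E) := by ring
    _ ≤ _ := by gcongr

theorem IsStaggeringlyGood.ergodic {A : Finset ℕ} {f : Ω → Equiv.Perm A}
    (hgood : IsStaggeringlyGood Ω T D I μ A f) : Ergodic (augMap T f) (augMeasure μ A) := by
  have hT := hgood.augmented.base
  have := hT.isProbabilityMeasure
  have := hT.isFiniteMeasure_lebesgueOn
  have := hgood.augmented.nonempty.to_subtype
  refine ⟨hgood.augmented.measurePreserving, ⟨fun E hE hinv => ?_⟩⟩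
  obtain ⟨M, hM, hren⟩ := hgood.renyi.exists_mul_le
  obtain ⟨s₀, hs₀, hstag⟩ := hgood.staggered
  have hiter : ∀ n p, (augMap T f)^[n] p ∈ E ↔ p ∈ E := by
    intro n
    induction n with
    | zero => simp
    | succ n ih =>
      intro p
      rw [Function.iterate_succ_apply, ih]
      exact Set.ext_iff.1 hinv p
  set sec : A → Set Ω := fun a => {x | (x, a) ∈ E} with hsec
  have hsecm : ∀ a, MeasurableSet (sec a) := fun a => measurable_prodMk_right hE
  -- Invariance of `E` under iterates transfers membership from level `b` at the end of the cylinder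
  -- back to level `a`.
  have hcyl : ∀ s a, ∃ b, (∀ x ∈ digitCylinder T I s,
      (augMap T f)^[s.length] (x, a) = (T^[s.length] x, b)) ∧
      T^[s.length] ⁻¹' sec b ∩ digitCylinder T I s ⊆ digitCylinder T I s ∩ sec a := by
    intro s a
    obtain ⟨b, hb⟩ := exists_augMap_iterate_eq (T := T) hgood.skew_const s a
    refine ⟨b, hb, fun x hx => ⟨hx.2, (hiter s.length _).1 ?_⟩⟩
    rw [hb x hx.2]
    exact hx.1
  rw [eventuallyConst_set']
  by_cases h0 : ∀ a, lebesgueOn Ω (sec a) = 0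
  · exact Or.inl (ae_eq_empty.2 (augMeasure_eq_zero fun a => hT.absolutelyContinuous (h0 a)))
  push Not at h0
  obtain ⟨b, hb⟩ := h0
  -- A prefix of the staggered string leads from level `a` to the non-null level `b`. By Rényi's
  -- condition, a null `sec a` would make the cylinder of that prefix null, and it contains the
  -- cylinder of `s₀`.
  have hpos : ∀ a, lebesgueOn Ω (sec a) ≠ 0 := by
    intro a
    obtain ⟨i, hi, hsub⟩ := hstag b a
    obtain ⟨b', hb', hle⟩ := hcyl (s₀.take i) a
    have hlen : (s₀.take i).length = i := by simp [hi.le]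
    obtain ⟨x, hx⟩ := nonempty_of_measure_ne_zero hs₀.ne'
    have hxb : b' = b := by
      have h1 := hb' x (digitCylinder_subset_take _ _ hx)
      have h2 := (hsub ⟨(x, a), ⟨hx, rfl⟩, rfl⟩).2
      rw [hlen] at h1
      rw [h1] at h2
      exact h2
    subst hxb
    have h3 := hren _ (hgood.admissible (s₀.take i)) _ (hsecm b')
    intro h4
    have h5 : lebesgueOn Ω (T^[(s₀.take i).length] ⁻¹' sec b' ∩ digitCylinder T I (s₀.take i))
        = 0 := measure_mono_null (hle.trans inter_subset_right) h4
    rw [h5, mul_zero, nonpos_iff_eq_zero, mul_eq_zero] at h3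
    refine h3.elim hb fun h6 => hs₀.ne' ?_
    exact hT.absolutelyContinuous (measure_mono_null (digitCylinder_subset_take _ _) h6)
  obtain ⟨a₀, ha₀⟩ := Finite.exists_min fun a => lebesgueOn Ω (sec a)
  refine Or.inr (ae_eq_univ.2 (augMeasure_eq_zero fun a => hT.absolutelyContinuous ?_))
  refine hT.lebesgueOn_compl_eq_zero (hsecm a) (hpos a₀) (measure_ne_top _ _) hM fun s => ?_
  obtain ⟨b', -, hle⟩ := hcyl s a
  calc _ ≤ lebesgueOn Ω (sec b') * lebesgueOn Ω (digitCylinder T I s) := by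
        exact mul_le_mul_left (ha₀ b') _
    _ ≤ _ := hren s (hgood.admissible s) _ (hsecm b')
    _ ≤ _ := mul_le_mul_right (measure_mono hle) _

end NumberTheoretic

/-! ### Transfer of normality between `T` and the augmented map -/

section AugmentedNormal

variable {Ω δ : Type*} {T : Ω → Ω} {I : δ → Set Ω} {A : Finset ℕ} {f : Ω → Equiv.Perm A}
  {dig : Ω → δ}

theorem birkhoffAverage_comp_fst (φ : Ω → ℝ) (N : ℕ) (p : Ω × A) :
    birkhoffAverage ℝ (augMap T f) (fun p => φ p.1) N p = birkhoffAverage ℝ T φ N p.1 := by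
  simp only [birkhoffAverage, birkhoffSum, augMap_iterate_fst]

/-- The initial level and the digits of `s` force all later levels. A non-empty string is needed
because the empty one does not record the initial level. -/
theorem exists_augMap_digitCylinder_eq (hskew : ∀ d, ∀ x ∈ I d, ∀ y ∈ I d, f x = f y)
    {s : List δ} (hs : s ≠ []) (a : A) : ∃ q : List (δ × A),
      digitCylinder (augMap T f) (augDigitSet I A) q = digitCylinder T I s ×ˢ {a} := by
  induction s generalizing a with
  | nil => exact absurd rfl hs
  | cons d s ih =>
    rcases eq_or_ne s [] with rfl | hs'
    · refine ⟨[(d, a)], ?_⟩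
      simp [digitCylinder, augDigitSet]
    · obtain ⟨g, hg⟩ := exists_skew_eq hskew d
      obtain ⟨q, hq⟩ := ih hs' (g a)
      refine ⟨(d, a) :: q, ?_⟩
      ext ⟨x, b⟩
      simp only [digitCylinder, hq, augDigitSet, augMap, mem_inter_iff, mem_prod, mem_preimage,
        mem_singleton_iff]
      constructor
      · rintro ⟨⟨h1, h2⟩, h3, -⟩
        exact ⟨⟨h1, h3⟩, h2⟩
      · rintro ⟨⟨h1, h3⟩, rfl⟩
        exact ⟨⟨h1, rfl⟩, h3, by rw [hg x h1]⟩

/-- One step of the map costs one more digit: the first selects the permutation, the others are the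
digits of `T x`. -/
theorem factorsThroughPrefix_comp_augMap {β : Type*} (hf : ∀ x y, dig x = dig y → f x = f y)
    {ψ : Ω × A → β} {k : ℕ} (h : ∀ a, FactorsThroughPrefix T dig k fun x => ψ (x, a)) (a : A) :
    FactorsThroughPrefix T dig (k + 1) fun x => ψ (augMap T f (x, a)) := by
  intro x y hxy
  have h0 : f x = f y := hf x y (hxy 0 k.succ_pos)
  simp only [augMap, h0]
  exact h _ _ _ fun j hj => hxy (j + 1) (Nat.succ_lt_succ hj)

theorem factorsThroughPrefix_comp_augMap_iterate {β : Type*}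
    (hf : ∀ x y, dig x = dig y → f x = f y) {ψ : Ω × A → β} {k : ℕ}
    (h : ∀ a, FactorsThroughPrefix T dig k fun x => ψ (x, a)) (n : ℕ) (a : A) :
    FactorsThroughPrefix T dig (k + n) fun x => ψ ((augMap T f)^[n] (x, a)) := by
  induction n generalizing a with
  | zero => exact h a
  | succ n ih =>
    exact factorsThroughPrefix_comp_augMap (ψ := fun p => ψ ((augMap T f)^[n] p)) hf ih a

theorem factorsThroughPrefix_mem_digitCylinder (hdig : ∀ x d, x ∈ I d ↔ dig x = d)
    (hf : ∀ x y, dig x = dig y → f x = f y) (q : List (δ × A)) (a : A) :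
    FactorsThroughPrefix T dig q.length
      fun x => (x, a) ∈ digitCylinder (augMap T f) (augDigitSet I A) q := by
  induction q generalizing a with
  | nil => intro x y _; rfl
  | cons d q ih =>
    intro x y hxy
    have h0 : dig x = dig y := hxy 0 (Nat.succ_pos _)
    have h1 := factorsThroughPrefix_comp_augMap hf
      (ψ := fun p => p ∈ digitCylinder (augMap T f) (augDigitSet I A) q) ih a x y hxy
    simp only [digitCylinder, mem_inter_iff, mem_preimage, augDigitSet, mem_prod, hdig, h0]
    exact congrArg _ h1

variable [MeasurableSpace Ω] {μ : Measure Ω}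

theorem isProbabilityMeasure_augMeasure [IsProbabilityMeasure μ] (hA : A.Nonempty) :
    IsProbabilityMeasure (augMeasure μ A) := by
  refine ⟨?_⟩
  have h : (A.card : ℝ≥0∞) ≠ 0 := by simpa using hA.ne_empty
  rw [augMeasure, Measure.smul_apply, ← univ_prod_univ, Measure.prod_prod]
  simp [ENNReal.inv_mul_cancel h]

theorem integral_augMeasure [IsProbabilityMeasure μ] {g : Ω × A → ℝ}
    (hg : Integrable g (μ.prod Measure.count)) :
    ∫ p, g p ∂(augMeasure μ A) = (A.card : ℝ)⁻¹ * ∑ a, ∫ x, g (x, a) ∂μ := by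
  rw [augMeasure, integral_smul_measure, integral_prod_symm g hg, integral_count]
  simp

theorem IsNormal.of_augMap [IsProbabilityMeasure μ] (hA : A.Nonempty)
    (hskew : ∀ d, ∀ x ∈ I d, ∀ y ∈ I d, f x = f y) {x : Ω} {a : A}
    (hx : IsNormal (augMap T f) (augDigitSet I A) (augMeasure μ A) (x, a)) :
    IsNormal T I μ x := by
  intro s hs
  have hcard : (A.card : ℝ) ≠ 0 := by simpa using hA.ne_empty
  simp only [visits_div_eq_birkhoffAverage]
  rcases eq_or_ne s [] with rfl | hne
  · simp only [digitCylinder, indicator_univ, measure_univ, ENNReal.toReal_one]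
    refine tendsto_const_nhds.congr' ?_
    filter_upwards [eventually_ne_atTop 0] with N hN
    exact (birkhoffAverage_fun_const 1 hN x).symm
  · have hlim : ∀ b : A, Tendsto (fun N => birkhoffAverage ℝ (augMap T f)
        ((digitCylinder T I s ×ˢ {b}).indicator 1) N (x, a)) atTop
        (𝓝 ((A.card : ℝ)⁻¹ * (μ (digitCylinder T I s)).toReal)) := by
      intro b
      obtain ⟨q, hq⟩ := exists_augMap_digitCylinder_eq (T := T) hskew hne b
      have h := hx q (by rw [Admissible, hq]; exact hs.prod (singleton_nonempty b))
      simpa only [visits_div_eq_birkhoffAverage, hq, augMeasure_prod_singleton,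
        ENNReal.toReal_mul, ENNReal.toReal_inv, ENNReal.toReal_natCast] using h
    have hsum := tendsto_finsetSum Finset.univ fun b _ => hlim b
    have hval : ∑ _b : A, (A.card : ℝ)⁻¹ * (μ (digitCylinder T I s)).toReal
        = (μ (digitCylinder T I s)).toReal := by
      simp [hcard]
    rw [hval] at hsum
    refine hsum.congr fun N => ?_
    rw [← birkhoffAverage_finset_sum, ← birkhoffAverage_comp_fst (f := f) _ N (x, a)]
    congr 1
    funext p
    classical
    simp only [indicator_apply, mem_prod, mem_singleton_iff, Pi.one_apply]
    by_cases h : p.1 ∈ digitCylinder T I s <;> simp [h]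

theorem IsNormal.augmented [IsProbabilityMeasure μ] [Countable δ] (hA : A.Nonempty)
    (hT : Measurable T) (hI : ∀ d, MeasurableSet (I d))
    (hdig : ∀ x d, x ∈ I d ↔ dig x = d)
    (hskew : ∀ d, ∀ x ∈ I d, ∀ y ∈ I d, f x = f y) (hadm : ∀ s, Admissible T I s)
    (herg : Ergodic (augMap T f) (augMeasure μ A)) {x : Ω} (hx : IsNormal T I μ x) (a : A) :
    IsNormal (augMap T f) (augDigitSet I A) (augMeasure μ A) (x, a) := by
  intro q _
  have := isProbabilityMeasure_augMeasure (μ := μ) hA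
  have hF := herg.measurable
  have hcard : (0 : ℝ) < A.card := by exact_mod_cast hA.card_pos
  have hf : ∀ x y, dig x = dig y → f x = f y := fun x y h =>
    hskew (dig y) x ((hdig _ _).2 h) y ((hdig _ _).2 rfl)
  set C := digitCylinder (augMap T f) (augDigitSet I A) q with hCdef
  have hC : MeasurableSet C := measurableSet_digitCylinder hF
    (fun d => (hI d.1).prod (measurableSet_singleton d.2)) q
  set φ : Ω × A → ℝ := C.indicator 1 with hφdef
  have hφm : Measurable φ := measurable_one.indicator hC
  have hφ01 : ∀ p, φ p ∈ Icc (0 : ℝ) 1 := by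
    classical
    intro p
    rw [hφdef, indicator_apply]
    split_ifs <;> simp
  have hφbdd : Bornology.IsBounded (range φ) :=
    (Metric.isBounded_Icc (0 : ℝ) 1).subset (range_subset_iff.2 hφ01)
  have hφk : ∀ b, FactorsThroughPrefix T dig q.length fun x => φ (x, b) := by
    classical
    intro b y z hyz
    have h := factorsThroughPrefix_mem_digitCylinder hdig hf q b y z hyz
    simp only [hφdef, indicator_apply, hCdef, h, Pi.one_apply]
  have hL2 : MemLp φ 2 (augMeasure μ A) := MemLp.of_bound hφm.aestronglyMeasurable 1
    (Eventually.of_forall fun p => by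
      rw [Real.norm_eq_abs, abs_of_nonneg (hφ01 p).1]; exact (hφ01 p).2)
  have hc : ∫ p, φ p ∂(augMeasure μ A) = (augMeasure μ A C).toReal := integral_indicator_one hC
  set c := (augMeasure μ A C).toReal
  have hc01 : c ∈ Icc (0 : ℝ) 1 := ⟨ENNReal.toReal_nonneg, measureReal_le_one⟩
  simp only [visits_div_eq_birkhoffAverage]
  rw [Metric.tendsto_atTop']
  suffices h : ∀ ε > 0, ∀ᶠ N in atTop,
      dist (birkhoffAverage ℝ (augMap T f) φ N (x, a)) c < ε by
    intro ε hε
    obtain ⟨N₀, hN₀⟩ := eventually_atTop.1 (h ε hε)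
    exact ⟨N₀, fun N hN => hN₀ N hN.le⟩
  intro ε hε
  have hmean := tendsto_integral_abs_birkhoffAverage_sub herg hL2
  rw [hc] at hmean
  -- The factor `1 / |A|` compensates for `H` below being an unnormalised sum over `A`, so that the
  -- integral of `H` is below `ε / 3`.
  obtain ⟨M, hM, hM0⟩ := ((hmean.eventually
    (gt_mem_nhds (show 0 < (A.card : ℝ)⁻¹ * (ε / 3) by positivity))).and
      (eventually_ne_atTop 0)).exists
  set g : Ω × A → ℝ := fun p =>
    |birkhoffAverage ℝ (augMap T f) φ M p - c| with hg
  have hgm : Measurable g := by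
    have h : Measurable fun p => (M : ℝ)⁻¹ * ∑ i ∈ Finset.range M, φ ((augMap T f)^[i] p) :=
      (Finset.measurable_sum _ fun i _ => hφm.comp (hF.iterate i)).const_mul _
    exact measurable_abs.comp (h.sub_const c)
  have hg01 : ∀ p, g p ∈ Icc (0 : ℝ) 1 := fun p => by
    have h := birkhoffAverage_mem_Icc (F := augMap T f) hφ01 M p
    exact ⟨abs_nonneg _, abs_le.2 ⟨by linarith [h.1, hc01.2], by linarith [h.2, hc01.1]⟩⟩
  have hgk : ∀ b, FactorsThroughPrefix T dig (q.length + M) fun x => g (x, b) := by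
    intro b y z hyz
    simp only [hg, birkhoffAverage, birkhoffSum]
    congr 3
    refine Finset.sum_congr rfl fun i hi => ?_
    exact ((factorsThroughPrefix_comp_augMap_iterate hf hφk i b).mono
      (Nat.add_le_add_left (Finset.mem_range.1 hi).le _)) y z hyz
  -- Normality of `x` says nothing directly about the levels visited by the orbit; summing over all
  -- of them dominates `g` by a function of the base point.
  set H : Ω → ℝ := fun x => ∑ b : A, g (x, b) with hH
  have hgsec : ∀ b, Measurable fun x => g (x, b) := fun b => hgm.comp measurable_prodMk_right
  have hgint : ∀ b, Integrable (fun x => g (x, b)) μ := fun b =>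
    Integrable.of_bound (hgsec b).aestronglyMeasurable 1 (Eventually.of_forall fun x => by
      rw [Real.norm_eq_abs, abs_of_nonneg (hg01 _).1]; exact (hg01 _).2)
  have hHint : ∫ y, H y ∂μ < ε / 3 := by
    have hgi : Integrable g (μ.prod Measure.count) :=
      Integrable.of_bound hgm.aestronglyMeasurable 1 (Eventually.of_forall fun x => by
        rw [Real.norm_eq_abs, abs_of_nonneg (hg01 _).1]; exact (hg01 _).2)
    rw [integral_augMeasure hgi] at hM
    rw [hH, integral_finsetSum _ fun b _ => hgint b]
    exact lt_of_mul_lt_mul_left hM (by positivity)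
  have hHN := hx.eventually_birkhoffAverage_le hdig (measurableSet_digitCylinder hT hI) hadm
    (H := H) (k := q.length + M) (B := A.card)
    (fun y z hyz => Finset.sum_congr rfl fun b _ => hgk b y z hyz)
    (Finset.measurable_sum _ fun b _ => hgsec b)
    (fun y => ⟨Finset.sum_nonneg fun b _ => (hg01 _).1, by
      refine (Finset.sum_le_card_nsmul _ _ 1 fun b _ => (hg01 _).2).trans ?_
      simp⟩) (show 0 < ε / 3 by positivity)
  have hdiff := (tendsto_birkhoffAverage_birkhoffAverage_sub
    (F := augMap T f) hφbdd hM0 (x, a)).eventually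
      (Metric.ball_mem_nhds (0 : ℝ) (show 0 < ε / 3 by positivity))
  filter_upwards [hHN, hdiff, eventually_ne_atTop 0] with N h1 h2 hN
  rw [dist_zero_right, Real.norm_eq_abs] at h2
  have h3 := abs_birkhoffAverage_sub_le (F := augMap T f)
    (birkhoffAverage ℝ (augMap T f) φ M) c hN (x, a)
  have h4 : birkhoffAverage ℝ (augMap T f) g N (x, a)
      ≤ birkhoffAverage ℝ T H N x := by
    rw [← birkhoffAverage_comp_fst (f := f) H N (x, a)]
    exact birkhoffAverage_mono N _ fun p =>
      Finset.single_le_sum (f := fun b => g (p.1, b)) (fun b _ => (hg01 _).1)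
        (Finset.mem_univ p.2)
  rw [Real.dist_eq]
  -- The average of `A_M φ` is within `∫ H + ε / 3 < 2 * ε / 3` of `c`; replacing it by the average
  -- of `φ` costs less than `ε / 3`.
  have h5 := h3.trans (h4.trans h1)
  rw [abs_lt] at h2 ⊢
  rw [abs_le] at h5
  constructor <;> linarith [h2.1, h2.2, h5.1, h5.2]

end AugmentedNormal

end NormalNumbers

/-! ### The main theorem -/

theorem theorem4 {m : ℕ} (Ω : Set (EuclideanSpace ℝ (Fin m))) (mΩ : MeasurableSpace Ω)
    (T : Ω → Ω) (D : Set ℕ) (I : D → Set Ω) (μ : Measure Ω)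
    (A : Finset ℕ) (f : Ω → Equiv.Perm A)
    (hgood : NormalNumbers.IsStaggeringlyGood Ω T D I μ A f) :
    Ergodic (NormalNumbers.augMap T f) (NormalNumbers.augMeasure μ A) ∧
    ∀ x : Ω,
      (NormalNumbers.IsNormal T I μ x ↔
        ∀ a : A, NormalNumbers.IsNormal (NormalNumbers.augMap T f)
          (NormalNumbers.augDigitSet I A) (NormalNumbers.augMeasure μ A) (x, a)) ∧
      (NormalNumbers.IsNormal T I μ x ↔
        ∃ a : A, NormalNumbers.IsNormal (NormalNumbers.augMap T f)
          (NormalNumbers.augDigitSet I A) (NormalNumbers.augMeasure μ A) (x, a)) := by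
  have hT := hgood.augmented.base
  have := hT.isProbabilityMeasure
  have hA := hgood.augmented.nonempty
  have herg := hgood.ergodic
  obtain ⟨dig, hdig⟩ := NormalNumbers.exists_digit hT.disjoint hT.cover
  have hforward : ∀ x, NormalNumbers.IsNormal T I μ x →
      ∀ a : A, NormalNumbers.IsNormal (NormalNumbers.augMap T f)
        (NormalNumbers.augDigitSet I A) (NormalNumbers.augMeasure μ A) (x, a) := fun x hx =>
    hx.augmented hA hT.measurable hT.measurableSet_digit hdig hgood.skew_const hgood.admissible herg
  refine ⟨herg, fun x => ⟨⟨hforward x, fun h => ?_⟩, ⟨fun h => ?_, fun ⟨a, h⟩ => ?_⟩⟩⟩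
  · exact (h ⟨_, hA.choose_spec⟩).of_augMap hA hgood.skew_const
  · exact ⟨⟨_, hA.choose_spec⟩, hforward x h _⟩
  · exact h.of_augMap hA hgood.skew_const
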